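/- Let $\mathcal{V}$ be a locally small, cocomplete, symmetric monoidal closed category with unit object $I$. For small $\mathcal{V}$-categories $\mathcal{B}$ and $\mathcal{C}$, a $\mathcal{V}$-module $M:\mathcal{B}\nrightarrow\mathcal{C}$ consists of objects $M(X,B)$ of $\mathcal{V}$ ($X\in\mathcal{C}$, $B\in\mathcal{B}$) with actions $\mathcal{C}(Y,X)\otimes M(X,B)\to M(Y,B)$ and $M(X,A)\otimes\mathcal{B}(A,B)\to M(X,B)$ that are unital, associative and commute with each other (equivalently, a $\mathcal{V}$-functor $\mathcal{C}^{\mathrm{op}}\otimes\mathcal{B}\to\mathcal{V}$); a module morphism is a family of maps $M(X,B)\to M'(X,B)$ commuting with the actions. With the composition $(M\circ N)(X,P)=\int^{A}M(X,A)\otimes N(A,P)$ and the hom-objects as identity modules, small $\mathcal{V}$-categories, modules and module morphisms form a bicategory $\mathcal{V}\text{-}\mathrm{Mod}$. A module is called Cauchy if it has a right adjoint in $\mathcal{V}\text{-}\mathrm{Mod}$. Let $\mathcal{I}$ be the $\mathcal{V}$-category with one object and hom-object $I$. A small $\mathcal{V}$-category $\mathcal{E}$ is called Cauchy complete if every Cauchy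 module $M:\mathcal{I}\nrightarrow\mathcal{E}$ is representable, i.e. isomorphic as a module to $\mathcal{E}(-,D)$ for some object $D$ of $\mathcal{E}$. Proposition. If a small $\mathcal{V}$-category $\mathcal{E}$ is Cauchy complete, then idempotents split in its underlying ordinary category $\mathcal{E}_0$ (with the same objects and with $\mathcal{E}_0(X,Y)=\mathcal{V}(I,\mathcal{E}(X,Y))$): for every $e:E\to E$ in $\mathcal{E}_0$ with $e\circ e=e$ there are an object $D$ and morphisms $r:E\to D$, $s:D\to E$ in $\mathcal{E}_0$ with $r\circ s=1_D$ and $s\circ r=e$. -/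

import Mathlib

open CategoryTheory MonoidalCategory Limits

universe w u

namespace EnrichedModule

/-! ## Enriched modules -/

section Modules

variable (V : Type u) [Category.{w} V] [MonoidalCategory V]

/-- A `V`-module `M : B ⇸ C` between `V`-categories, i.e. a `V`-functor `Cᵒᵖ ⊗ B ⟶ V`, presented
by its objects `M(x, b)` and the left action of `C` and the right action of `B`.
Recall that `eComp V x y z : C(x, y) ⊗ C(y, z) ⟶ C(x, z)`. -/
structure VModule (B C : Type w) [EnrichedCategory V B] [EnrichedCategory V C] where
  /-- The object `M(x, b)` of `V`. -/
  obj : C → B → V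
  /-- The action `C(x, y) ⊗ M(y, b) ⟶ M(x, b)`. -/
  actL (x y : C) (b : B) : (EnrichedCategory.Hom x y : V) ⊗ obj y b ⟶ obj x b
  /-- The action `M(x, a) ⊗ B(a, b) ⟶ M(x, b)`. -/
  actR (x : C) (a b : B) : obj x a ⊗ (EnrichedCategory.Hom a b : V) ⟶ obj x b
  actL_id (x : C) (b : B) : eId V x ▷ obj x b ≫ actL x x b = (λ_ (obj x b)).hom
  actL_comp (x y z : C) (b : B) :
    eComp V x y z ▷ obj z b ≫ actL x z b =
      (α_ _ _ _).hom ≫ EnrichedCategory.Hom x y ◁ actL y z b ≫ actL x y b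
  actR_id (x : C) (b : B) : obj x b ◁ eId V b ≫ actR x b b = (ρ_ (obj x b)).hom
  actR_comp (x : C) (a b c : B) :
    obj x a ◁ eComp V a b c ≫ actR x a c =
      (α_ _ _ _).inv ≫ actR x a b ▷ EnrichedCategory.Hom b c ≫ actR x b c
  act_comm (x y : C) (a b : B) :
    actL x y a ▷ EnrichedCategory.Hom a b ≫ actR x a b =
      (α_ _ _ _).hom ≫ EnrichedCategory.Hom x y ◁ actR y a b ≫ actL x y b

variable {V}
variable {B C D E F : Type w} [EnrichedCategory V B] [EnrichedCategory V C] [EnrichedCategory V D]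
  [EnrichedCategory V E] [EnrichedCategory V F]

/-- A morphism of `V`-modules: a family of maps of `V` that commutes with both actions. -/
@[ext]
structure ModHom (M N : VModule V B C) where
  app (x : C) (b : B) : M.obj x b ⟶ N.obj x b
  actL_app (x y : C) (b : B) :
    M.actL x y b ≫ app x b = EnrichedCategory.Hom x y ◁ app y b ≫ N.actL x y b
  actR_app (x : C) (a b : B) :
    M.actR x a b ≫ app x b = app x a ▷ EnrichedCategory.Hom a b ≫ N.actR x a b

instance : Category (VModule V B C) where
  Hom M N := ModHom M N
  id M := { app := fun x b => 𝟙 _, actL_app := by simp, actR_app := by simp }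
  comp f g :=
    { app := fun x b => f.app x b ≫ g.app x b
      actL_app := fun x y b => by
        rw [← Category.assoc, f.actL_app, Category.assoc, g.actL_app,
          MonoidalCategory.whiskerLeft_comp, Category.assoc]
      actR_app := fun x a b => by
        rw [← Category.assoc, f.actR_app, Category.assoc, g.actR_app,
          MonoidalCategory.comp_whiskerRight, Category.assoc] }

@[ext]
theorem hom_ext {M N : VModule V B C} {f g : M ⟶ N} (h : ∀ x b, f.app x b = g.app x b) : f = g :=
  ModHom.ext (funext fun x => funext fun b => h x b)

@[simp]
theorem id_app (M : VModule V B C) (x : C) (b : B) : ModHom.app (𝟙 M) x b = 𝟙 _ := rfl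

@[simp]
theorem comp_app {M N P : VModule V B C} (f : M ⟶ N) (g : N ⟶ P) (x : C) (b : B) :
    (f ≫ g).app x b = f.app x b ≫ g.app x b := rfl

/-- An isomorphism of `V`-modules from a morphism with invertible components. -/
def isoMk {M N : VModule V B C} (f : M ⟶ N) (g : ∀ x b, N.obj x b ⟶ M.obj x b)
    (h : ∀ x b, f.app x b ≫ g x b = 𝟙 _) (h' : ∀ x b, g x b ≫ f.app x b = 𝟙 _) : M ≅ N where
  hom := f
  inv :=
    { app := g
      actL_app := fun x y b => by
        have e : N.actL x y b =
            EnrichedCategory.Hom x y ◁ g y b ≫ M.actL x y b ≫ f.app x b := by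
          rw [f.actL_app, ← MonoidalCategory.whiskerLeft_comp_assoc, h']; simp
        rw [e]; simp [h]
      actR_app := fun x a b => by
        have e : N.actR x a b =
            g x a ▷ EnrichedCategory.Hom a b ≫ M.actR x a b ≫ f.app x b := by
          rw [f.actR_app, ← MonoidalCategory.comp_whiskerRight_assoc, h']; simp
        rw [e]; simp [h] }
  hom_inv_id := by ext x b; exact h x b
  inv_hom_id := by ext x b; exact h' x b

variable (V) in
/-- The identity module `1_B : B ⇸ B`, given by the hom-objects of `B`. -/
abbrev idModule (B : Type w) [EnrichedCategory V B] : VModule V B B where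
  obj x b := EnrichedCategory.Hom x b
  actL x y b := eComp V x y b
  actR x a b := eComp V x a b
  actL_id x b := by
    have h := e_id_comp V x b
    rw [Iso.inv_comp_eq, Category.comp_id] at h
    exact h
  actL_comp x y z b := by rw [e_assoc']
  actR_id x b := by
    have h := e_comp_id V x b
    rw [Iso.inv_comp_eq, Category.comp_id] at h
    exact h
  actR_comp x a b c := by rw [e_assoc]
  act_comm x y a b := by rw [e_assoc']

end Modules

/-! ## Composition of modules -/

section JointlyEpi

variable {V : Type u} [Category.{w} V]

/-- A family of maps with common codomain is jointly epi. -/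
def JointlyEpi {ι : Type w} {A : ι → V} {X : V} (e : ∀ i, A i ⟶ X) : Prop :=
  ∀ ⦃Z : V⦄ (f g : X ⟶ Z), (∀ i, e i ≫ f = e i ≫ g) → f = g

variable [MonoidalCategory V] [MonoidalClosed V]

theorem JointlyEpi.whiskerLeft {ι : Type w} {A : ι → V} {X : V} {e : ∀ i, A i ⟶ X}
    (h : JointlyEpi e) (W : V) : JointlyEpi (fun i => W ◁ e i) := by
  intro Z f g hfg
  apply MonoidalClosed.curry_injective
  apply h
  intro i
  rw [← MonoidalClosed.curry_natural_left, ← MonoidalClosed.curry_natural_left, hfg i]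

theorem JointlyEpi.whiskerRight [SymmetricCategory V] {ι : Type w} {A : ι → V} {X : V} {e : ∀ i, A i ⟶ X}
    (h : JointlyEpi e) (W : V) : JointlyEpi (fun i => e i ▷ W) := by
  intro Z f g hfg
  rw [← cancel_epi (β_ W X).hom]
  apply h.whiskerLeft W
  intro i
  rw [BraidedCategory.braiding_naturality_right_assoc,
    BraidedCategory.braiding_naturality_right_assoc, hfg i]

end JointlyEpi

section Coend

variable {V : Type u} [Category.{w} V] [MonoidalCategory V] [HasColimits V]
variable {B C D E F : Type w} [EnrichedCategory V B] [EnrichedCategory V C] [EnrichedCategory V D]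
  [EnrichedCategory V E] [EnrichedCategory V F]

/-- The diagram whose colimit is the coend `∫^a M(x, a) ⊗ N(a, b)`: it has the two parallel maps
`(M(x, a) ⊗ C(a, a')) ⊗ N(a', b) ⇉ M(x, a') ⊗ N(a', b), M(x, a) ⊗ N(a, b)`
given by the actions, for all `a` and `a'` in `C`. -/
def coendIndex (M : VModule V C D) (N : VModule V B C) (x : D) (b : B) :
    MultispanIndex (MultispanShape.prod C) V where
  left p := (M.obj x p.1 ⊗ EnrichedCategory.Hom p.1 p.2) ⊗ N.obj p.2 b
  right a := M.obj x a ⊗ N.obj a b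
  fst p := (α_ _ _ _).hom ≫ M.obj x p.1 ◁ N.actL p.1 p.2 b
  snd p := M.actR x p.1 p.2 ▷ N.obj p.2 b

/-- The coend `∫^a M(x, a) ⊗ N(a, b)`. -/
noncomputable def coend (M : VModule V C D) (N : VModule V B C) (x : D) (b : B) : V :=
  multicoequalizer (coendIndex M N x b)

/-- The coprojections of the coend. -/
noncomputable def ι (M : VModule V C D) (N : VModule V B C) (x : D) (a : C) (b : B) :
    M.obj x a ⊗ N.obj a b ⟶ coend M N x b :=
  Multicoequalizer.π (coendIndex M N x b) a

theorem ι_condition (M : VModule V C D) (N : VModule V B C) (x : D) (a a' : C) (b : B) :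
    M.actR x a a' ▷ N.obj a' b ≫ ι M N x a' b =
      (α_ _ _ _).hom ≫ M.obj x a ◁ N.actL a a' b ≫ ι M N x a b := by
  have h := Multicoequalizer.condition (coendIndex M N x b) (a, a')
  rw [← Category.assoc]
  exact h.symm

theorem ι_condition_assoc (M : VModule V C D) (N : VModule V B C) (x : D) (a a' : C) (b : B)
    {Z : V} (k : coend M N x b ⟶ Z) :
    M.actR x a a' ▷ N.obj a' b ≫ ι M N x a' b ≫ k =
      (α_ _ _ _).hom ≫ M.obj x a ◁ N.actL a a' b ≫ ι M N x a b ≫ k := by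
  simpa using ι_condition M N x a a' b =≫ k

theorem ι_epi (M : VModule V C D) (N : VModule V B C) (x : D) (b : B) :
    JointlyEpi (fun a => ι M N x a b) := fun _ f g h =>
  Multicoequalizer.hom_ext (coendIndex M N x b) f g h

/-- The universal property of the coend. -/
noncomputable def desc (M : VModule V C D) (N : VModule V B C) (x : D) (b : B) {Z : V}
    (f : ∀ a, M.obj x a ⊗ N.obj a b ⟶ Z)
    (h : ∀ a a', M.actR x a a' ▷ N.obj a' b ≫ f a' =
      (α_ _ _ _).hom ≫ M.obj x a ◁ N.actL a a' b ≫ f a) : coend M N x b ⟶ Z :=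
  Multicoequalizer.desc (coendIndex M N x b) Z f
    (fun p => (Category.assoc _ _ _).trans (h p.1 p.2).symm)

@[simp]
theorem ι_desc (M : VModule V C D) (N : VModule V B C) (x : D) (b : B) {Z : V}
    (f : ∀ a, M.obj x a ⊗ N.obj a b ⟶ Z)
    (h : ∀ a a', M.actR x a a' ▷ N.obj a' b ≫ f a' =
      (α_ _ _ _).hom ≫ M.obj x a ◁ N.actL a a' b ≫ f a) (a : C) :
    ι M N x a b ≫ desc M N x b f h = f a :=
  Multicoequalizer.π_desc _ _ _ _ _

theorem compL_aux (M : VModule V C D) (N : VModule V B C) (x y : D) (b : B) (a a' : C) :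
    EnrichedCategory.Hom x y ◁ (M.actR y a a' ▷ N.obj a' b) ≫
        ((α_ _ _ _).inv ≫ M.actL x y a' ▷ N.obj a' b ≫ ι M N x a' b) =
      EnrichedCategory.Hom x y ◁ ((α_ _ _ _).hom ≫ M.obj y a ◁ N.actL a a' b) ≫
        ((α_ _ _ _).inv ≫ M.actL x y a ▷ N.obj a b ≫ ι M N x a b) := by
  have h := M.act_comm x y a a'
  rw [← Iso.inv_comp_eq] at h
  rw [associator_inv_naturality_middle_assoc, ← comp_whiskerRight_assoc, ← h]
  simp only [comp_whiskerRight, Category.assoc, ι_condition, associator_naturality_left_assoc,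
    ← whisker_exchange_assoc]
  simp

theorem compR_aux (M : VModule V C D) (N : VModule V B C) (x : D) (b b' : B) (a a' : C) :
    (M.actR x a a' ▷ N.obj a' b) ▷ EnrichedCategory.Hom b b' ≫
        ((α_ _ _ _).hom ≫ M.obj x a' ◁ N.actR a' b b' ≫ ι M N x a' b') =
      ((α_ _ _ _).hom ≫ M.obj x a ◁ N.actL a a' b) ▷ EnrichedCategory.Hom b b' ≫
        ((α_ _ _ _).hom ≫ M.obj x a ◁ N.actR a b b' ≫ ι M N x a b') := by
  rw [associator_naturality_left_assoc, ← whisker_exchange_assoc, ι_condition]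
  simp only [comp_whiskerRight, Category.assoc, associator_naturality_middle_assoc]
  rw [← MonoidalCategory.whiskerLeft_comp_assoc, N.act_comm]
  simp

variable [MonoidalClosed V]

/-- The universal property of `W ⊗ ∫^a M(x, a) ⊗ N(a, b)`. -/
noncomputable def descL (M : VModule V C D) (N : VModule V B C) (x : D) (b : B) (W : V) {Z : V}
    (f : ∀ a, W ⊗ (M.obj x a ⊗ N.obj a b) ⟶ Z)
    (h : ∀ a a', W ◁ (M.actR x a a' ▷ N.obj a' b) ≫ f a' =
      W ◁ ((α_ _ _ _).hom ≫ M.obj x a ◁ N.actL a a' b) ≫ f a) : W ⊗ coend M N x b ⟶ Z :=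
  MonoidalClosed.uncurry (desc M N x b (fun a => MonoidalClosed.curry (f a)) (fun a a' => by
    rw [← Category.assoc, ← MonoidalClosed.curry_natural_left, h,
      MonoidalClosed.curry_natural_left]))

@[simp]
theorem ι_descL (M : VModule V C D) (N : VModule V B C) (x : D) (b : B) (W : V) {Z : V}
    (f : ∀ a, W ⊗ (M.obj x a ⊗ N.obj a b) ⟶ Z)
    (h : ∀ a a', W ◁ (M.actR x a a' ▷ N.obj a' b) ≫ f a' =
      W ◁ ((α_ _ _ _).hom ≫ M.obj x a ◁ N.actL a a' b) ≫ f a) (a : C) :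
    W ◁ ι M N x a b ≫ descL M N x b W f h = f a := by
  rw [descL, ← MonoidalClosed.uncurry_natural_left, ι_desc, MonoidalClosed.uncurry_curry]

variable [SymmetricCategory V]

/-- The universal property of `(∫^a M(x, a) ⊗ N(a, b)) ⊗ W`. -/
noncomputable def descR (M : VModule V C D) (N : VModule V B C) (x : D) (b : B) (W : V) {Z : V}
    (f : ∀ a, (M.obj x a ⊗ N.obj a b) ⊗ W ⟶ Z)
    (h : ∀ a a', (M.actR x a a' ▷ N.obj a' b) ▷ W ≫ f a' =
      ((α_ _ _ _).hom ≫ M.obj x a ◁ N.actL a a' b) ▷ W ≫ f a) : coend M N x b ⊗ W ⟶ Z :=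
  (β_ _ _).hom ≫ descL M N x b W (fun a => (β_ _ _).hom ≫ f a) (fun a a' => by
    rw [BraidedCategory.braiding_naturality_right_assoc, h,
      ← BraidedCategory.braiding_naturality_right_assoc])

@[simp]
theorem ι_descR (M : VModule V C D) (N : VModule V B C) (x : D) (b : B) (W : V) {Z : V}
    (f : ∀ a, (M.obj x a ⊗ N.obj a b) ⊗ W ⟶ Z)
    (h : ∀ a a', (M.actR x a a' ▷ N.obj a' b) ▷ W ≫ f a' =
      ((α_ _ _ _).hom ≫ M.obj x a ◁ N.actL a a' b) ▷ W ≫ f a) (a : C) :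
    ι M N x a b ▷ W ≫ descR M N x b W f h = f a := by
  rw [descR, BraidedCategory.braiding_naturality_left_assoc, ι_descL,
    SymmetricCategory.symmetry_assoc]

end Coend

section Composition

variable {V : Type u} [Category.{w} V] [MonoidalCategory V] [SymmetricCategory V]
  [MonoidalClosed V] [HasColimits V]
variable {B C D E F : Type w} [EnrichedCategory V B] [EnrichedCategory V C] [EnrichedCategory V D]
  [EnrichedCategory V E] [EnrichedCategory V F]

/-- The composite of modules `N : B ⇸ C` and `M : C ⇸ D`, with
`(M ∘ N)(x, b) = ∫^a M(x, a) ⊗ N(a, b)`. -/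
noncomputable def compModule (M : VModule V C D) (N : VModule V B C) : VModule V B D where
  obj x b := coend M N x b
  actL x y b := descL M N y b (EnrichedCategory.Hom x y)
    (fun a => (α_ _ _ _).inv ≫ M.actL x y a ▷ N.obj a b ≫ ι M N x a b)
    (compL_aux M N x y b)
  actR x b b' := descR M N x b (EnrichedCategory.Hom b b')
    (fun a => (α_ _ _ _).hom ≫ M.obj x a ◁ N.actR a b b' ≫ ι M N x a b')
    (compR_aux M N x b b')
  actL_id x b := by
    apply (ι_epi M N x b).whiskerLeft
    intro a
    rw [whisker_exchange_assoc, ι_descL]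
    have h := M.actL_id x a
    have h' : eId V x ▷ (M.obj x a ⊗ N.obj a b) ≫ (α_ _ _ _).inv ≫ M.actL x x a ▷ N.obj a b =
        (α_ _ _ _).inv ≫ (λ_ (M.obj x a)).hom ▷ N.obj a b := by
      rw [← h]; simp
    rw [reassoc_of% h']
    simp
  actL_comp x y z b := by
    apply (ι_epi M N z b).whiskerLeft
    intro a
    rw [whisker_exchange_assoc, ι_descL]
    have h := M.actL_comp x y z a
    have h' : eComp V x y z ▷ (M.obj z a ⊗ N.obj a b) ≫ (α_ _ _ _).inv ≫
        M.actL x z a ▷ N.obj a b =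
        (α_ _ _ _).inv ≫ (eComp V x y z ▷ M.obj z a ≫ M.actL x z a) ▷ N.obj a b := by simp
    rw [reassoc_of% h', h, associator_naturality_right_assoc,
      ← MonoidalCategory.whiskerLeft_comp_assoc, ι_descL]
    simp
  actR_id x b := by
    apply (ι_epi M N x b).whiskerRight
    intro a
    rw [← whisker_exchange_assoc, ι_descR]
    have h := N.actR_id a b
    have h' : (M.obj x a ⊗ N.obj a b) ◁ eId V b ≫ (α_ _ _ _).hom ≫ M.obj x a ◁ N.actR a b b =
        (α_ _ _ _).hom ≫ M.obj x a ◁ (ρ_ (N.obj a b)).hom := by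
      rw [← h]; simp
    rw [reassoc_of% h']
    simp
  actR_comp x b b' b'' := by
    apply (ι_epi M N x b).whiskerRight
    intro a
    rw [← whisker_exchange_assoc, ι_descR]
    have h := N.actR_comp a b b' b''
    have h' : (M.obj x a ⊗ N.obj a b) ◁ eComp V b b' b'' ≫ (α_ _ _ _).hom ≫
        M.obj x a ◁ N.actR a b b'' =
        (α_ _ _ _).hom ≫ M.obj x a ◁ (N.obj a b ◁ eComp V b b' b'' ≫ N.actR a b b'') := by simp
    rw [reassoc_of% h', h, associator_inv_naturality_left_assoc,
      ← MonoidalCategory.comp_whiskerRight_assoc, ι_descR]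
    simp
  act_comm x y b b' := by
    apply ((ι_epi M N y b).whiskerLeft _).whiskerRight
    intro a
    rw [← MonoidalCategory.comp_whiskerRight_assoc, ι_descL, associator_naturality_middle_assoc,
      ← MonoidalCategory.whiskerLeft_comp_assoc, ι_descR]
    simp only [comp_whiskerRight, Category.assoc, ι_descR, associator_naturality_left_assoc,
      ← whisker_exchange_assoc, MonoidalCategory.whiskerLeft_comp, ι_descL]
    simp

/-- The coprojections of `(M ∘ N)(x, b) = ∫^a M(x, a) ⊗ N(a, b)`. -/
noncomputable def inj (M : VModule V C D) (N : VModule V B C) (x : D) (a : C) (b : B) :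
    M.obj x a ⊗ N.obj a b ⟶ (compModule M N).obj x b :=
  ι M N x a b

theorem inj_epi (M : VModule V C D) (N : VModule V B C) (x : D) (b : B) :
    JointlyEpi (fun a => inj M N x a b) :=
  ι_epi M N x b

theorem inj_condition (M : VModule V C D) (N : VModule V B C) (x : D) (a a' : C) (b : B) :
    M.actR x a a' ▷ N.obj a' b ≫ inj M N x a' b =
      (α_ _ _ _).hom ≫ M.obj x a ◁ N.actL a a' b ≫ inj M N x a b :=
  ι_condition M N x a a' b

theorem inj_actL (M : VModule V C D) (N : VModule V B C) (x y : D) (a : C) (b : B) :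
    EnrichedCategory.Hom x y ◁ inj M N y a b ≫ (compModule M N).actL x y b =
      (α_ _ _ _).inv ≫ M.actL x y a ▷ N.obj a b ≫ inj M N x a b :=
  ι_descL M N y b _ _ (compL_aux M N x y b) a

theorem inj_actR (M : VModule V C D) (N : VModule V B C) (x : D) (a : C) (b b' : B) :
    inj M N x a b ▷ EnrichedCategory.Hom b b' ≫ (compModule M N).actR x b b' =
      (α_ _ _ _).hom ≫ M.obj x a ◁ N.actR a b b' ≫ inj M N x a b' :=
  ι_descR M N x b _ _ (compR_aux M N x b b') a

/-- The universal property of `(M ∘ N)(x, b)`. -/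
noncomputable def lift (M : VModule V C D) (N : VModule V B C) (x : D) (b : B) {Z : V}
    (f : ∀ a, M.obj x a ⊗ N.obj a b ⟶ Z)
    (h : ∀ a a', M.actR x a a' ▷ N.obj a' b ≫ f a' =
      (α_ _ _ _).hom ≫ M.obj x a ◁ N.actL a a' b ≫ f a) : (compModule M N).obj x b ⟶ Z :=
  desc M N x b f h

theorem inj_lift (M : VModule V C D) (N : VModule V B C) (x : D) (b : B) {Z : V}
    (f : ∀ a, M.obj x a ⊗ N.obj a b ⟶ Z)
    (h : ∀ a a', M.actR x a a' ▷ N.obj a' b ≫ f a' =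
      (α_ _ _ _).hom ≫ M.obj x a ◁ N.actL a a' b ≫ f a) (a : C) :
    inj M N x a b ≫ lift M N x b f h = f a :=
  ι_desc M N x b f h a

/-- The universal property of `W ⊗ (M ∘ N)(x, b)`. -/
noncomputable def liftL (M : VModule V C D) (N : VModule V B C) (x : D) (b : B) (W : V) {Z : V}
    (f : ∀ a, W ⊗ (M.obj x a ⊗ N.obj a b) ⟶ Z)
    (h : ∀ a a', W ◁ (M.actR x a a' ▷ N.obj a' b) ≫ f a' =
      W ◁ ((α_ _ _ _).hom ≫ M.obj x a ◁ N.actL a a' b) ≫ f a) :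
    W ⊗ (compModule M N).obj x b ⟶ Z :=
  descL M N x b W f h

theorem inj_liftL (M : VModule V C D) (N : VModule V B C) (x : D) (b : B) (W : V) {Z : V}
    (f : ∀ a, W ⊗ (M.obj x a ⊗ N.obj a b) ⟶ Z)
    (h : ∀ a a', W ◁ (M.actR x a a' ▷ N.obj a' b) ≫ f a' =
      W ◁ ((α_ _ _ _).hom ≫ M.obj x a ◁ N.actL a a' b) ≫ f a) (a : C) :
    W ◁ inj M N x a b ≫ liftL M N x b W f h = f a :=
  ι_descL M N x b W f h a

/-- The universal property of `(M ∘ N)(x, b) ⊗ W`. -/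
noncomputable def liftR (M : VModule V C D) (N : VModule V B C) (x : D) (b : B) (W : V) {Z : V}
    (f : ∀ a, (M.obj x a ⊗ N.obj a b) ⊗ W ⟶ Z)
    (h : ∀ a a', (M.actR x a a' ▷ N.obj a' b) ▷ W ≫ f a' =
      ((α_ _ _ _).hom ≫ M.obj x a ◁ N.actL a a' b) ▷ W ≫ f a) :
    (compModule M N).obj x b ⊗ W ⟶ Z :=
  descR M N x b W f h

theorem inj_liftR (M : VModule V C D) (N : VModule V B C) (x : D) (b : B) (W : V) {Z : V}
    (f : ∀ a, (M.obj x a ⊗ N.obj a b) ⊗ W ⟶ Z)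
    (h : ∀ a a', (M.actR x a a' ▷ N.obj a' b) ▷ W ≫ f a' =
      ((α_ _ _ _).hom ≫ M.obj x a ◁ N.actL a a' b) ▷ W ≫ f a) (a : C) :
    inj M N x a b ▷ W ≫ liftR M N x b W f h = f a :=
  ι_descR M N x b W f h a

/-- The map `f ∘ N : M ∘ N ⟶ M' ∘ N`. -/
noncomputable def whiskR {M M' : VModule V C D} (f : M ⟶ M') (N : VModule V B C) :
    compModule M N ⟶ compModule M' N where
  app x b := lift M N x b (fun a => f.app x a ▷ N.obj a b ≫ inj M' N x a b) (fun a a' => by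
    rw [← comp_whiskerRight_assoc, f.actR_app, comp_whiskerRight, Category.assoc, inj_condition,
      associator_naturality_left_assoc, whisker_exchange_assoc])
  actL_app x y b := by
    apply (inj_epi M N y b).whiskerLeft
    intro a
    have h := f.actL_app x y a
    rw [reassoc_of% inj_actL, inj_lift,
      ← comp_whiskerRight_assoc, h, ← MonoidalCategory.whiskerLeft_comp_assoc, inj_lift,
      MonoidalCategory.whiskerLeft_comp_assoc, inj_actL]
    simp
  actR_app x b b' := by
    apply (inj_epi M N x b).whiskerRight
    intro a
    rw [reassoc_of% inj_actR, inj_lift,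
      ← comp_whiskerRight_assoc, inj_lift, comp_whiskerRight_assoc, inj_actR,
      whisker_exchange_assoc]
    simp

theorem inj_whiskR {M M' : VModule V C D} (f : M ⟶ M') (N : VModule V B C)
    (x : D) (a : C) (b : B) :
    inj M N x a b ≫ (whiskR f N).app x b = f.app x a ▷ N.obj a b ≫ inj M' N x a b := by
  simp only [whiskR, inj_lift]

/-- The map `M ∘ g : M ∘ N ⟶ M ∘ N'`. -/
noncomputable def whiskL (M : VModule V C D) {N N' : VModule V B C} (g : N ⟶ N') :
    compModule M N ⟶ compModule M N' where
  app x b := lift M N x b (fun a => M.obj x a ◁ g.app a b ≫ inj M N' x a b) (fun a a' => by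
    rw [← MonoidalCategory.whiskerLeft_comp_assoc, g.actL_app, ← whisker_exchange_assoc,
      inj_condition]
    simp)
  actL_app x y b := by
    apply (inj_epi M N y b).whiskerLeft
    intro a
    rw [reassoc_of% inj_actL, inj_lift,
      ← MonoidalCategory.whiskerLeft_comp_assoc, inj_lift,
      MonoidalCategory.whiskerLeft_comp_assoc, inj_actL, ← whisker_exchange_assoc]
    simp
  actR_app x b b' := by
    apply (inj_epi M N x b).whiskerRight
    intro a
    have h := g.actR_app a b b'
    rw [reassoc_of% inj_actR, inj_lift,
      ← MonoidalCategory.whiskerLeft_comp_assoc, h, ← comp_whiskerRight_assoc, inj_lift,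
      comp_whiskerRight_assoc, inj_actR]
    simp

theorem inj_whiskL (M : VModule V C D) {N N' : VModule V B C} (g : N ⟶ N')
    (x : D) (a : C) (b : B) :
    inj M N x a b ≫ (whiskL M g).app x b = M.obj x a ◁ g.app a b ≫ inj M N' x a b := by
  simp only [whiskL, inj_lift]

/-- The left unit isomorphism `1_C ∘ M ≅ M`, given by the action of `C`. -/
noncomputable def unitL (M : VModule V B C) : compModule (idModule V C) M ≅ M :=
  isoMk
    { app := fun x b => lift (idModule V C) M x b (fun y => M.actL x y b)
        (fun y y' => M.actL_comp x y y' b)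
      actL_app := fun x y b => by
        apply (inj_epi (idModule V C) M y b).whiskerLeft
        intro a
        rw [reassoc_of% inj_actL, inj_lift, ← MonoidalCategory.whiskerLeft_comp_assoc, inj_lift]
        have h := M.actL_comp x y a b
        rw [← Iso.inv_comp_eq] at h
        exact h
      actR_app := fun x b b' => by
        apply (inj_epi (idModule V C) M x b).whiskerRight
        intro a
        rw [reassoc_of% inj_actR, inj_lift, ← comp_whiskerRight_assoc, inj_lift]
        exact (M.act_comm x a b b').symm }
    (fun x b => (λ_ _).inv ≫ eId V x ▷ M.obj x b ≫ inj (idModule V C) M x x b)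
    (fun x b => by
      apply inj_epi (idModule V C) M x b
      intro y
      have h := inj_condition (idModule V C) M x x y b
      rw [← Iso.inv_comp_eq] at h
      rw [reassoc_of% inj_lift, leftUnitor_inv_naturality_assoc, whisker_exchange_assoc,
        ← h]
      have h' : (α_ (𝟙_ V) _ (M.obj y b)).hom ≫ eId V x ▷ (EnrichedCategory.Hom x y ⊗ M.obj y b) ≫
          (α_ (EnrichedCategory.Hom x x) _ _).inv ≫ eComp V x x y ▷ M.obj y b =
            (λ_ (EnrichedCategory.Hom x y)).hom ▷ M.obj y b := by
        rw [← (idModule V C).actL_id x y]; simp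
      rw [← Iso.eq_inv_comp] at h'
      rw [reassoc_of% h']
      simp)
    (fun x b => by simp [inj_lift, M.actL_id])

/-- The right unit isomorphism `M ∘ 1_B ≅ M`, given by the action of `B`. -/
noncomputable def unitR (M : VModule V B C) : compModule M (idModule V B) ≅ M :=
  isoMk
    { app := fun x b => lift M (idModule V B) x b (fun a => M.actR x a b)
        (fun a a' => by
          have h := M.actR_comp x a a' b
          rw [h]
          simp)
      actL_app := fun x y b => by
        apply (inj_epi M (idModule V B) y b).whiskerLeft
        intro a
        rw [reassoc_of% inj_actL, inj_lift, ← MonoidalCategory.whiskerLeft_comp_assoc, inj_lift]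
        have h := M.act_comm x y a b
        rw [← Iso.inv_comp_eq] at h
        exact h
      actR_app := fun x b b' => by
        apply (inj_epi M (idModule V B) x b).whiskerRight
        intro a
        rw [reassoc_of% inj_actR, inj_lift, ← comp_whiskerRight_assoc, inj_lift]
        have h := M.actR_comp x a b b'
        rw [Iso.eq_inv_comp] at h
        exact h }
    (fun x b => (ρ_ _).inv ≫ M.obj x b ◁ eId V b ≫ inj M (idModule V B) x b b)
    (fun x b => by
      apply inj_epi M (idModule V B) x b
      intro a
      have h := inj_condition M (idModule V B) x a b b
      rw [reassoc_of% inj_lift, rightUnitor_inv_naturality_assoc, ← whisker_exchange_assoc]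
      have h' := (idModule V B).actR_id a b
      rw [h, associator_naturality_right_assoc, ← MonoidalCategory.whiskerLeft_comp_assoc, h']
      simp)
    (fun x b => by simp [inj_lift, M.actR_id])

theorem assoc_aux (M : VModule V D E) (N : VModule V C D) (P : VModule V B C) (x : E) (b : B)
    (a : C) (d d' : D) :
    (M.actR x d d' ▷ N.obj d' a) ▷ P.obj a b ≫
        ((α_ _ _ _).hom ≫ M.obj x d' ◁ inj N P d' a b ≫ inj M (compModule N P) x d' b) =
      ((α_ _ _ _).hom ≫ M.obj x d ◁ N.actL d d' a) ▷ P.obj a b ≫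
        ((α_ _ _ _).hom ≫ M.obj x d ◁ inj N P d a b ≫ inj M (compModule N P) x d b) := by
  rw [associator_naturality_left_assoc, ← whisker_exchange_assoc, inj_condition,
    associator_naturality_right_assoc]
  have h := inj_actL N P d d' a b
  rw [← MonoidalCategory.whiskerLeft_comp_assoc _ (_ ◁ inj N P d' a b), h]
  simp

/-- The map `(M ∘ N)(x, a) ⊗ P(a, b) ⟶ (M ∘ (N ∘ P))(x, b)`. -/
noncomputable def assocAux (M : VModule V D E) (N : VModule V C D) (P : VModule V B C)
    (x : E) (a : C) (b : B) :
    (compModule M N).obj x a ⊗ P.obj a b ⟶ (compModule M (compModule N P)).obj x b :=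
  liftR M N x a (P.obj a b)
    (fun d => (α_ _ _ _).hom ≫ M.obj x d ◁ inj N P d a b ≫ inj M (compModule N P) x d b)
    (assoc_aux M N P x b a)

theorem inj_assocAux (M : VModule V D E) (N : VModule V C D) (P : VModule V B C)
    (x : E) (d : D) (a : C) (b : B) :
    inj M N x d a ▷ P.obj a b ≫ assocAux M N P x a b =
      (α_ _ _ _).hom ≫ M.obj x d ◁ inj N P d a b ≫ inj M (compModule N P) x d b :=
  inj_liftR M N x a (P.obj a b) _ (assoc_aux M N P x b a) d

theorem assoc_aux' (M : VModule V D E) (N : VModule V C D) (P : VModule V B C) (x : E) (b : B)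
    (d : D) (a a' : C) :
    M.obj x d ◁ (N.actR d a a' ▷ P.obj a' b) ≫
        ((α_ _ _ _).inv ≫ inj M N x d a' ▷ P.obj a' b ≫ inj (compModule M N) P x a' b) =
      M.obj x d ◁ ((α_ _ _ _).hom ≫ N.obj d a ◁ P.actL a a' b) ≫
        ((α_ _ _ _).inv ≫ inj M N x d a ▷ P.obj a b ≫ inj (compModule M N) P x a b) := by
  have h := inj_actR M N x d a a'
  have h₂ := inj_condition (compModule M N) P x a a' b
  rw [← Iso.inv_comp_eq] at h
  rw [associator_inv_naturality_middle_assoc, ← comp_whiskerRight_assoc, ← h]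
  simp only [comp_whiskerRight, Category.assoc, h₂, associator_naturality_left_assoc,
    ← whisker_exchange_assoc]
  simp

/-- The map `M(x, d) ⊗ (N ∘ P)(d, b) ⟶ ((M ∘ N) ∘ P)(x, b)`. -/
noncomputable def assocAux' (M : VModule V D E) (N : VModule V C D) (P : VModule V B C)
    (x : E) (d : D) (b : B) :
    M.obj x d ⊗ (compModule N P).obj d b ⟶ (compModule (compModule M N) P).obj x b :=
  liftL N P d b (M.obj x d)
    (fun a => (α_ _ _ _).inv ≫ inj M N x d a ▷ P.obj a b ≫ inj (compModule M N) P x a b)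
    (assoc_aux' M N P x b d)

theorem inj_assocAux' (M : VModule V D E) (N : VModule V C D) (P : VModule V B C)
    (x : E) (d : D) (a : C) (b : B) :
    M.obj x d ◁ inj N P d a b ≫ assocAux' M N P x d b =
      (α_ _ _ _).inv ≫ inj M N x d a ▷ P.obj a b ≫ inj (compModule M N) P x a b :=
  inj_liftL N P d b (M.obj x d) _ (assoc_aux' M N P x b d) a

/-- The underlying maps of the associator `(M ∘ N) ∘ P ⟶ M ∘ (N ∘ P)`. -/
noncomputable def assocApp (M : VModule V D E) (N : VModule V C D) (P : VModule V B C)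
    (x : E) (b : B) :
    (compModule (compModule M N) P).obj x b ⟶ (compModule M (compModule N P)).obj x b :=
  lift (compModule M N) P x b (fun a => assocAux M N P x a b) (fun a a' => by
    apply ((inj_epi M N x a).whiskerRight _).whiskerRight
    intro d
    have h := inj_actR N P d
    simp only [← comp_whiskerRight_assoc, inj_actR]
    simp only [comp_whiskerRight, Category.assoc, inj_assocAux, associator_naturality_left_assoc]
    rw [← whisker_exchange_assoc, inj_assocAux, associator_naturality_middle_assoc,
      ← MonoidalCategory.whiskerLeft_comp_assoc, inj_condition]
    simp)

theorem inj_assocApp (M : VModule V D E) (N : VModule V C D) (P : VModule V B C)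
    (x : E) (a : C) (b : B) :
    inj (compModule M N) P x a b ≫ assocApp M N P x b = assocAux M N P x a b := by
  simp only [assocApp, inj_lift]

/-- The underlying maps of the inverse associator `M ∘ (N ∘ P) ⟶ (M ∘ N) ∘ P`. -/
noncomputable def assocApp' (M : VModule V D E) (N : VModule V C D) (P : VModule V B C)
    (x : E) (b : B) :
    (compModule M (compModule N P)).obj x b ⟶ (compModule (compModule M N) P).obj x b :=
  lift M (compModule N P) x b (fun d => assocAux' M N P x d b) (fun d d' => by
    apply (inj_epi N P d' b).whiskerLeft
    intro a
    rw [whisker_exchange_assoc, inj_assocAux', associator_naturality_right_assoc,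
      ← MonoidalCategory.whiskerLeft_comp_assoc, inj_actL]
    simp only [MonoidalCategory.whiskerLeft_comp, Category.assoc, inj_assocAux',
      associator_inv_naturality_left_assoc]
    rw [← comp_whiskerRight_assoc, inj_condition]
    simp)

theorem inj_assocApp' (M : VModule V D E) (N : VModule V C D) (P : VModule V B C)
    (x : E) (d : D) (b : B) :
    inj M (compModule N P) x d b ≫ assocApp' M N P x b = assocAux' M N P x d b := by
  simp only [assocApp', inj_lift]

theorem inj_inj_assocApp (M : VModule V D E) (N : VModule V C D) (P : VModule V B C)
    (x : E) (d : D) (a : C) (b : B) :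
    inj M N x d a ▷ P.obj a b ≫ inj (compModule M N) P x a b ≫ assocApp M N P x b =
      (α_ _ _ _).hom ≫ M.obj x d ◁ inj N P d a b ≫ inj M (compModule N P) x d b := by
  rw [inj_assocApp, inj_assocAux]

theorem inj_inj_assocApp' (M : VModule V D E) (N : VModule V C D) (P : VModule V B C)
    (x : E) (d : D) (a : C) (b : B) :
    M.obj x d ◁ inj N P d a b ≫ inj M (compModule N P) x d b ≫ assocApp' M N P x b =
      (α_ _ _ _).inv ≫ inj M N x d a ▷ P.obj a b ≫ inj (compModule M N) P x a b := by
  rw [inj_assocApp', inj_assocAux']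

/-- Maps out of `((M ∘ N) ∘ P)(x, b)` are determined on the `(M(x, d) ⊗ N(d, a)) ⊗ P(a, b)`. -/
theorem comp_ext (M : VModule V D E) (N : VModule V C D) (P : VModule V B C) (x : E) (b : B)
    {Z : V} {f g : (compModule (compModule M N) P).obj x b ⟶ Z}
    (h : ∀ d a, inj M N x d a ▷ P.obj a b ≫ inj (compModule M N) P x a b ≫ f =
      inj M N x d a ▷ P.obj a b ≫ inj (compModule M N) P x a b ≫ g) : f = g := by
  apply inj_epi
  intro a
  apply (inj_epi M N x a).whiskerRight
  intro d
  exact h d a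

/-- Maps out of `(M ∘ (N ∘ P))(x, b)` are determined on the `M(x, d) ⊗ (N(d, a) ⊗ P(a, b))`. -/
theorem comp_ext' (M : VModule V D E) (N : VModule V C D) (P : VModule V B C) (x : E) (b : B)
    {Z : V} {f g : (compModule M (compModule N P)).obj x b ⟶ Z}
    (h : ∀ d a, M.obj x d ◁ inj N P d a b ≫ inj M (compModule N P) x d b ≫ f =
      M.obj x d ◁ inj N P d a b ≫ inj M (compModule N P) x d b ≫ g) : f = g := by
  apply inj_epi
  intro d
  apply (inj_epi N P d b).whiskerLeft
  intro a
  exact h d a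

/-- The associativity isomorphism `(M ∘ N) ∘ P ≅ M ∘ (N ∘ P)`. -/
noncomputable def assoc (M : VModule V D E) (N : VModule V C D) (P : VModule V B C) :
    compModule (compModule M N) P ≅ compModule M (compModule N P) :=
  isoMk
    { app := fun x b => assocApp M N P x b
      actL_app := fun x y b => by
        apply (inj_epi _ _ _ _).whiskerLeft
        intro a
        apply ((inj_epi _ _ _ _).whiskerRight _).whiskerLeft
        intro d
        rw [reassoc_of% inj_actL, inj_assocApp, associator_inv_naturality_middle_assoc,
          ← comp_whiskerRight_assoc, inj_actL, ← MonoidalCategory.whiskerLeft_comp_assoc,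
          ← MonoidalCategory.whiskerLeft_comp_assoc, Category.assoc, inj_inj_assocApp]
        simp only [comp_whiskerRight, MonoidalCategory.whiskerLeft_comp, Category.assoc,
          inj_assocAux, inj_actL, associator_naturality_left_assoc, ← whisker_exchange_assoc]
        simp
      actR_app := fun x b b' => by
        apply (inj_epi _ _ _ _).whiskerRight
        intro a
        apply ((inj_epi _ _ _ _).whiskerRight _).whiskerRight
        intro d
        rw [reassoc_of% inj_actR, inj_assocApp, associator_naturality_left_assoc,
          ← whisker_exchange_assoc, inj_assocAux, ← comp_whiskerRight_assoc,
          ← comp_whiskerRight_assoc, Category.assoc, inj_inj_assocApp]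
        simp only [comp_whiskerRight, Category.assoc, inj_actR,
          associator_naturality_middle_assoc]
        rw [← MonoidalCategory.whiskerLeft_comp_assoc, inj_actR]
        simp }
    (fun x b => assocApp' M N P x b)
    (fun x b => by
      apply comp_ext
      intro d a
      rw [reassoc_of% inj_inj_assocApp, inj_inj_assocApp']
      simp)
    (fun x b => by
      apply comp_ext'
      intro d a
      rw [reassoc_of% inj_inj_assocApp', inj_inj_assocApp]
      simp)

theorem inj_unitL (M : VModule V B C) (x y : C) (b : B) :
    inj (idModule V C) M x y b ≫ (unitL M).hom.app x b = M.actL x y b :=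
  inj_lift (idModule V C) M x b _ (fun y y' => M.actL_comp x y y' b) y

theorem inj_unitR (M : VModule V B C) (x : C) (a b : B) :
    inj M (idModule V B) x a b ≫ (unitR M).hom.app x b = M.actR x a b := by
  simp only [unitR, isoMk, inj_lift]

theorem inj_inj_assoc (M : VModule V D E) (N : VModule V C D) (P : VModule V B C)
    (x : E) (d : D) (a : C) (b : B) :
    inj M N x d a ▷ P.obj a b ≫ inj (compModule M N) P x a b ≫ (assoc M N P).hom.app x b =
      (α_ _ _ _).hom ≫ M.obj x d ◁ inj N P d a b ≫ inj M (compModule N P) x d b :=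
  inj_inj_assocApp M N P x d a b

theorem inj_inj_assoc' (M : VModule V D E) (N : VModule V C D) (P : VModule V B C)
    (x : E) (d : D) (a : C) (b : B) :
    M.obj x d ◁ inj N P d a b ≫ inj M (compModule N P) x d b ≫ (assoc M N P).inv.app x b =
      (α_ _ _ _).inv ≫ inj M N x d a ▷ P.obj a b ≫ inj (compModule M N) P x a b :=
  inj_inj_assocApp' M N P x d a b

theorem whiskR_id (M : VModule V C D) (N : VModule V B C) :
    whiskR (𝟙 M) N = 𝟙 (compModule M N) := by
  ext x b
  apply inj_epi
  intro a
  rw [inj_whiskR]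
  simp

theorem whiskL_id (M : VModule V C D) (N : VModule V B C) :
    whiskL M (𝟙 N) = 𝟙 (compModule M N) := by
  ext x b
  apply inj_epi
  intro a
  rw [inj_whiskL]
  simp

theorem whiskR_comp {M M' M'' : VModule V C D} (f : M ⟶ M') (g : M' ⟶ M'') (N : VModule V B C) :
    whiskR (f ≫ g) N = whiskR f N ≫ whiskR g N := by
  ext x b
  apply inj_epi
  intro a
  rw [comp_app, inj_whiskR, reassoc_of% inj_whiskR, inj_whiskR]
  simp

theorem whiskL_comp (M : VModule V C D) {N N' N'' : VModule V B C} (f : N ⟶ N') (g : N' ⟶ N'') :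
    whiskL M (f ≫ g) = whiskL M f ≫ whiskL M g := by
  ext x b
  apply inj_epi
  intro a
  rw [comp_app, inj_whiskL, reassoc_of% inj_whiskL, inj_whiskL]
  simp

theorem whisk_exchange {M M' : VModule V C D} {N N' : VModule V B C} (f : M ⟶ M') (g : N ⟶ N') :
    whiskL M g ≫ whiskR f N' = whiskR f N ≫ whiskL M' g := by
  ext x b
  apply inj_epi
  intro a
  rw [comp_app, comp_app, reassoc_of% inj_whiskL, reassoc_of% inj_whiskR, inj_whiskL, inj_whiskR,
    whisker_exchange_assoc]

theorem unitL_natural {M N : VModule V B C} (f : M ⟶ N) :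
    whiskL (idModule V C) f ≫ (unitL N).hom = (unitL M).hom ≫ f := by
  ext x b
  apply inj_epi
  intro a
  rw [comp_app, comp_app, reassoc_of% inj_whiskL, reassoc_of% inj_unitL, inj_unitL, f.actL_app]

theorem unitR_natural {M N : VModule V B C} (f : M ⟶ N) :
    whiskR f (idModule V B) ≫ (unitR N).hom = (unitR M).hom ≫ f := by
  ext x b
  apply inj_epi
  intro a
  rw [comp_app, comp_app, reassoc_of% inj_whiskR, reassoc_of% inj_unitR, inj_unitR, f.actR_app]

theorem assoc_natural_left {M M' : VModule V D E} (f : M ⟶ M') (N : VModule V C D)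
    (P : VModule V B C) :
    whiskR (whiskR f N) P ≫ (assoc M' N P).hom =
      (assoc M N P).hom ≫ whiskR f (compModule N P) := by
  ext x b
  apply comp_ext
  intro d a
  rw [comp_app, comp_app, reassoc_of% inj_inj_assoc, inj_whiskR, reassoc_of% inj_whiskR,
    ← comp_whiskerRight_assoc, inj_whiskR, comp_whiskerRight_assoc, inj_inj_assoc,
    associator_naturality_left_assoc, ← whisker_exchange_assoc]

theorem assoc_natural_middle (M : VModule V D E) {N N' : VModule V C D} (f : N ⟶ N')
    (P : VModule V B C) :
    whiskR (whiskL M f) P ≫ (assoc M N' P).hom =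
      (assoc M N P).hom ≫ whiskL M (whiskR f P) := by
  ext x b
  apply comp_ext
  intro d a
  rw [comp_app, comp_app, reassoc_of% inj_inj_assoc, inj_whiskL, reassoc_of% inj_whiskR,
    ← comp_whiskerRight_assoc, inj_whiskL, comp_whiskerRight_assoc, inj_inj_assoc,
    ← MonoidalCategory.whiskerLeft_comp_assoc, inj_whiskR]
  simp

theorem assoc_natural_right (M : VModule V D E) (N : VModule V C D) {P P' : VModule V B C}
    (f : P ⟶ P') :
    whiskL (compModule M N) f ≫ (assoc M N P').hom =
      (assoc M N P).hom ≫ whiskL M (whiskL N f) := by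
  ext x b
  apply comp_ext
  intro d a
  rw [comp_app, comp_app, reassoc_of% inj_inj_assoc, inj_whiskL, reassoc_of% inj_whiskL,
    ← whisker_exchange_assoc, inj_inj_assoc,
    ← MonoidalCategory.whiskerLeft_comp_assoc, inj_whiskL]
  simp

theorem assoc_pentagon {A : Type w} [EnrichedCategory V A] (M : VModule V D E) (N : VModule V C D)
    (P : VModule V B C) (Q : VModule V A B) :
    whiskR (assoc M N P).hom Q ≫ (assoc M (compModule N P) Q).hom ≫ whiskL M (assoc N P Q).hom =
      (assoc (compModule M N) P Q).hom ≫ (assoc M N (compModule P Q)).hom := by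
  ext x q
  apply comp_ext
  intro c b
  apply ((inj_epi M N x c).whiskerRight _).whiskerRight
  intro d
  simp only [comp_app]
  rw [reassoc_of% inj_whiskR, reassoc_of% inj_inj_assoc, associator_naturality_left_assoc,
    ← whisker_exchange_assoc, inj_inj_assoc,
    ← comp_whiskerRight_assoc, ← comp_whiskerRight_assoc, Category.assoc, inj_inj_assoc]
  simp only [comp_whiskerRight, Category.assoc]
  rw [reassoc_of% inj_inj_assoc, inj_whiskL, associator_naturality_middle_assoc,
    ← MonoidalCategory.whiskerLeft_comp_assoc, ← MonoidalCategory.whiskerLeft_comp_assoc,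
    Category.assoc, inj_inj_assoc]
  simp

theorem assoc_pentagon_inv {A : Type w} [EnrichedCategory V A] (M : VModule V D E)
    (N : VModule V C D) (P : VModule V B C) (Q : VModule V A B) :
    whiskL M (assoc N P Q).inv ≫ (assoc M (compModule N P) Q).inv ≫ whiskR (assoc M N P).inv Q =
      (assoc M N (compModule P Q)).inv ≫ (assoc (compModule M N) P Q).inv := by
  have h₁ : whiskL M (assoc N P Q).hom ≫ whiskL M (assoc N P Q).inv = 𝟙 _ := by
    rw [← whiskL_comp, Iso.hom_inv_id, whiskL_id]
  have h₂ : whiskR (assoc M N P).hom Q ≫ whiskR (assoc M N P).inv Q = 𝟙 _ := by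
    rw [← whiskR_comp, Iso.hom_inv_id, whiskR_id]
  rw [← cancel_epi (assoc M N (compModule P Q)).hom,
    ← cancel_epi (assoc (compModule M N) P Q).hom]
  have h := assoc_pentagon M N P Q =≫ (whiskL M (assoc N P Q).inv ≫
    (assoc M (compModule N P) Q).inv ≫ whiskR (assoc M N P).inv Q)
  simp only [Category.assoc] at h
  rw [reassoc_of% h₁, Iso.hom_inv_id_assoc, h₂] at h
  rw [← h]
  simp

theorem assoc_triangle (M : VModule V C D) (N : VModule V B C) :
    (assoc M (idModule V C) N).hom ≫ whiskL M (unitL N).hom = whiskR (unitR M).hom N := by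
  ext x b
  apply comp_ext
  intro c a
  rw [comp_app, reassoc_of% inj_inj_assoc, inj_whiskL, inj_whiskR,
    ← MonoidalCategory.whiskerLeft_comp_assoc, inj_unitL, ← comp_whiskerRight_assoc, inj_unitR,
    inj_condition]

end Composition

/-! ## The bicategory `V-Mod` and Cauchy completeness -/

section Mod

variable (V : Type u) [Category.{w} V] [MonoidalCategory V]

/-- A small `V`-category, regarded as an object of `V-Mod`. -/
structure ModCat where
  carrier : Type w
  [str : EnrichedCategory V carrier]

attribute [instance] ModCat.str

/-- The type with one object `⋆` underlying the unit `V`-category. -/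
inductive UnitCat : Type w
  | star : UnitCat

/-- The unit `V`-category `ℐ`, with one object and the unit object of `V` as hom-object. -/
instance : EnrichedCategory V UnitCat.{w} where
  Hom _ _ := 𝟙_ V
  id _ := 𝟙 _
  comp _ _ _ := (λ_ (𝟙_ V)).hom
  id_comp _ _ := by simp
  comp_id _ _ := by simp [unitors_equal]
  assoc _ _ _ _ := by simp [unitors_equal]

variable {V} in
/-- The module `X_* : ℐ ⇸ E` represented by an object `X` of `E`,
with `X_*(Y) = E(Y, X)`. -/
def representable {E : Type w} [EnrichedCategory V E] (X : E) : VModule V UnitCat.{w} E where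
  obj y _ := EnrichedCategory.Hom y X
  actL y z _ := eComp V y z X
  actR y _ _ := (ρ_ _).hom
  actL_id y _ := (idModule V E).actL_id y X
  actL_comp y z t _ := (idModule V E).actL_comp y z t X
  actR_id y _ := by
    change _ ◁ 𝟙 _ ≫ _ = _
    simp
  actR_comp y _ _ _ := by
    change EnrichedCategory.Hom y X ◁ (λ_ (𝟙_ V)).hom ≫ (ρ_ _).hom =
      (α_ _ (𝟙_ V) (𝟙_ V)).inv ≫ (ρ_ (EnrichedCategory.Hom y X)).hom ▷ 𝟙_ V ≫ (ρ_ _).hom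
    rw [← triangle_assoc, Iso.inv_hom_id_assoc]
  act_comm y z _ _ := by
    change eComp V y z X ▷ 𝟙_ V ≫ (ρ_ _).hom =
      (α_ _ _ (𝟙_ V)).hom ≫ EnrichedCategory.Hom y z ◁ (ρ_ (EnrichedCategory.Hom z X)).hom ≫
        eComp V y z X
    simp

variable [SymmetricCategory V] [MonoidalClosed V] [HasColimits V]

/-- The bicategory `V-Mod` of small `V`-categories and `V`-modules. Mathlib writes the composite
of `N : B ⟶ C` and `M : C ⟶ D` as `N ≫ M`; it is `M ∘ N`, computed by coends over `C`. -/
noncomputable instance : Bicategory (ModCat.{w} V) where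
  Hom B C := VModule V B.carrier C.carrier
  id B := idModule V B.carrier
  comp N M := compModule M N
  homCategory _ _ := inferInstance
  whiskerLeft N _ _ f := whiskR f N
  whiskerRight g M := whiskL M g
  associator P N M := (assoc M N P).symm
  leftUnitor M := unitR M
  rightUnitor M := unitL M
  whiskerLeft_id N M := whiskR_id M N
  whiskerLeft_comp N _ _ _ f g := whiskR_comp f g N
  id_whiskerLeft f := by
    rw [← Category.assoc, Iso.eq_comp_inv]
    exact unitR_natural f
  comp_whiskerLeft P N _ _ f := by
    simp only [Iso.symm_hom, Iso.symm_inv]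
    rw [Iso.eq_inv_comp]
    exact (assoc_natural_left f N P).symm
  id_whiskerRight N M := whiskL_id M N
  comp_whiskerRight f g M := whiskL_comp M f g
  whiskerRight_id f := by
    rw [← Category.assoc, Iso.eq_comp_inv]
    exact unitL_natural f
  whiskerRight_comp f N M := by
    simp only [Iso.symm_hom, Iso.symm_inv]
    rw [← Category.assoc, Iso.eq_comp_inv]
    exact assoc_natural_right M N f
  whisker_assoc P _ _ f M := by
    simp only [Iso.symm_hom, Iso.symm_inv]
    rw [Iso.eq_inv_comp]
    exact (assoc_natural_middle M f P).symm
  whisker_exchange f g := (whisk_exchange g f).symm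
  pentagon Q P N M := by
    exact assoc_pentagon_inv M N P Q
  triangle N M := by
    simp only [Iso.symm_hom]
    rw [Iso.inv_comp_eq]
    exact (assoc_triangle M N).symm

variable {V} in
/-- A `V`-module `M : B ⇸ C` is Cauchy if it has a right adjoint in the bicategory `V-Mod`. -/
def IsCauchy {B C : Type w} [EnrichedCategory V B] [EnrichedCategory V C]
    (M : VModule V B C) : Prop :=
  ∃ N : VModule V C B,
    Nonempty (Bicategory.Adjunction (a := ModCat.mk (V := V) B) (b := ModCat.mk (V := V) C) M N)

/-- A small `V`-category `E` is Cauchy complete if every Cauchy module `M : ℐ ⇸ E` is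
representable. -/
def IsCauchyComplete (E : Type w) [EnrichedCategory V E] : Prop :=
  ∀ M : VModule V UnitCat.{w} E, IsCauchy M → ∃ X : E, Nonempty (M ≅ representable X)

end Mod

end EnrichedModule

namespace CategoryTheory

theorem Idempotents.isIdempotentComplete_of_hasCoequalizers (C : Type u) [Category.{w} C]
    [HasCoequalizers C] : IsIdempotentComplete C := by
  refine ⟨fun X p hp => ?_⟩
  have hπ : p ≫ coequalizer.π p (𝟙 X) = coequalizer.π p (𝟙 X) := by
    rw [coequalizer.condition, Category.id_comp]
  have hs : coequalizer.π p (𝟙 X) ≫ coequalizer.desc p (by rw [hp, Category.id_comp]) = p :=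
    coequalizer.π_desc _ _
  refine ⟨coequalizer p (𝟙 X), coequalizer.desc p (by rw [hp, Category.id_comp]),
    coequalizer.π p (𝟙 X), ?_, hs⟩
  apply coequalizer.hom_ext
  rw [reassoc_of% hs, hπ, Category.comp_id]

namespace Bicategory

local infixr:80 " ⊚≫ " => CategoryTheory.bicategoricalComp

theorem leftZigzag_eq {B : Type*} [Bicategory B] {a b : B} {f : a ⟶ b} {g : b ⟶ a}
    (η : 𝟙 a ⟶ f ≫ g) (θ : g ≫ f ⟶ 𝟙 b) :
    leftZigzag η θ = η ▷ f ≫ (associator f g f).hom ≫ f ◁ θ := by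
  simp [leftZigzag, bicategoricalComp]

theorem rightZigzag_eq {B : Type*} [Bicategory B] {a b : B} {f : a ⟶ b} {g : b ⟶ a}
    (η : 𝟙 a ⟶ f ≫ g) (θ : g ≫ f ⟶ 𝟙 b) :
    rightZigzag η θ = g ◁ η ≫ (associator g f g).inv ≫ θ ▷ g := by
  simp [rightZigzag, bicategoricalComp]

/-- If `f ⊣ g`, then a retract `m` of `f` is left adjoint to a retract `n` of `g`, provided that
the two idempotents are mates. -/
def Adjunction.retract {B : Type*} [Bicategory B] {a b : B} {f m : a ⟶ b} {g n : b ⟶ a}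
    (adj : f ⊣ g) (i : m ⟶ f) (p : f ⟶ m) (hm : i ≫ p = 𝟙 m) (j : n ⟶ g) (q : g ⟶ n)
    (hn : j ≫ q = 𝟙 n) (h : g ◁ (p ≫ i) ≫ adj.counit = (q ≫ j) ▷ f ≫ adj.counit) : m ⊣ n where
  unit := adj.unit ≫ p ▷ g ≫ m ◁ q
  counit := j ▷ m ≫ g ◁ i ≫ adj.counit
  left_triangle := by
    have hi : i ≫ p ≫ i = i := by rw [reassoc_of% hm]
    calc
      _ = adj.unit ▷ m ⊚≫ p ▷ g ▷ m ⊚≫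
            m ◁ (((q ≫ j) ▷ m ≫ g ◁ i) ≫ adj.counit) := by
        dsimp only [leftZigzag]; bicategory
      _ = adj.unit ▷ m ⊚≫ p ▷ g ▷ m ⊚≫ m ◁ (g ◁ (i ≫ p ≫ i) ≫ adj.counit) := by
        rw [← whisker_exchange, Category.assoc, ← h]; bicategory
      _ = adj.unit ▷ m ⊚≫ (p ▷ (g ≫ m) ≫ m ◁ (g ◁ i ≫ adj.counit)) ⊚≫ 𝟙 _ := by
        rw [hi]; bicategory
      _ = (adj.unit ▷ m ≫ (f ≫ g) ◁ i) ⊚≫ (f ◁ adj.counit ≫ p ▷ 𝟙 b) ⊚≫ 𝟙 _ := by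
        rw [← whisker_exchange p]; bicategory
      _ = 𝟙 a ◁ i ≫ leftZigzag adj.unit adj.counit ≫ p ▷ 𝟙 b := by
        rw [← whisker_exchange adj.unit i]; dsimp only [leftZigzag]; bicategory
      _ = (leftUnitor m).hom ≫ (i ≫ p) ≫ (rightUnitor m).inv := by
        rw [adj.left_triangle]; bicategory
      _ = _ := by rw [hm]; simp
  right_triangle := by
    have hj : j ≫ q ≫ j = j := by rw [reassoc_of% hn]
    calc
      _ = n ◁ adj.unit ⊚≫ n ◁ p ▷ g ⊚≫ ((n ≫ m) ◁ q ≫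
            (j ▷ m ≫ g ◁ i ≫ adj.counit) ▷ n) := by
        dsimp only [rightZigzag]; bicategory
      _ = n ◁ adj.unit ⊚≫ (n ◁ p ≫ j ▷ m) ▷ g ⊚≫ (g ◁ i ≫ adj.counit) ▷ g ≫ 𝟙 b ◁ q := by
        rw [whisker_exchange]; bicategory
      _ = n ◁ adj.unit ⊚≫ (j ▷ f ≫ g ◁ (p ≫ i) ≫ adj.counit) ▷ g ≫ 𝟙 b ◁ q := by
        rw [whisker_exchange]; bicategory
      _ = n ◁ adj.unit ⊚≫ ((j ≫ q ≫ j) ▷ f ≫ adj.counit) ▷ g ≫ 𝟙 b ◁ q := by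
        rw [h]; bicategory
      _ = (n ◁ adj.unit ≫ j ▷ (f ≫ g)) ⊚≫ adj.counit ▷ g ≫ 𝟙 b ◁ q := by
        rw [hj]; bicategory
      _ = j ▷ 𝟙 a ≫ rightZigzag adj.unit adj.counit ≫ 𝟙 b ◁ q := by
        rw [whisker_exchange]; dsimp only [rightZigzag]; bicategory
      _ = (rightUnitor n).hom ≫ (j ≫ q) ≫ (leftUnitor n).inv := by
        rw [adj.right_triangle]; bicategory
      _ = _ := by rw [hn]; simp

end Bicategory

end CategoryTheory

namespace EnrichedModule

variable {V : Type u} [Category.{w} V] [MonoidalCategory V]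

section Splitting

variable {B C : Type w} [EnrichedCategory V B] [EnrichedCategory V C]

/-- A componentwise splitting of an idempotent module endomorphism carries a module structure. -/
abbrev retractModule {M : VModule V B C} (e : M ⟶ M) (K : C → B → V)
    (s : ∀ x b, K x b ⟶ M.obj x b) (r : ∀ x b, M.obj x b ⟶ K x b)
    (hsr : ∀ x b, s x b ≫ r x b = 𝟙 _) (hrs : ∀ x b, r x b ≫ s x b = e.app x b) :
    VModule V B C where
  obj := K
  actL x y b := _ ◁ s y b ≫ M.actL x y b ≫ r x b
  actR x a b := s x a ▷ _ ≫ M.actR x a b ≫ r x b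
  actL_id x b := by
    rw [← whisker_exchange_assoc, reassoc_of% M.actL_id x b, leftUnitor_naturality_assoc, hsr,
      Category.comp_id]
  actL_comp x y z b := by
    have hs : s y b ≫ e.app y b = s y b := by rw [← hrs, reassoc_of% hsr]
    have hr : e.app x b ≫ r x b = r x b := by rw [← hrs, Category.assoc, hsr, Category.comp_id]
    have h := e.actL_app x y b
    rw [← whisker_exchange_assoc, reassoc_of% M.actL_comp x y z b]
    simp only [MonoidalCategory.whiskerLeft_comp, Category.assoc]
    rw [← MonoidalCategory.whiskerLeft_comp_assoc _ (r y b), hrs, ← reassoc_of% h, hr]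
    simp
  actR_id x b := by
    rw [whisker_exchange_assoc, reassoc_of% M.actR_id x b, rightUnitor_naturality_assoc, hsr,
      Category.comp_id]
  actR_comp x a b c := by
    have hr : e.app x c ≫ r x c = r x c := by rw [← hrs, Category.assoc, hsr, Category.comp_id]
    have h := e.actR_app x b c
    rw [whisker_exchange_assoc, reassoc_of% M.actR_comp x a b c]
    simp only [comp_whiskerRight, Category.assoc]
    rw [← comp_whiskerRight_assoc (r x b), hrs, ← reassoc_of% h, hr]
    simp
  act_comm x y a b := by
    have hr : e.app x b ≫ r x b = r x b := by rw [← hrs, Category.assoc, hsr, Category.comp_id]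
    have h := e.actR_app x a b
    have h' := e.actL_app x y b
    simp only [comp_whiskerRight, MonoidalCategory.whiskerLeft_comp, Category.assoc]
    rw [← comp_whiskerRight_assoc (r x a), hrs, ← reassoc_of% h, hr,
      ← MonoidalCategory.whiskerLeft_comp_assoc _ (r y b), hrs, ← reassoc_of% h', hr,
      reassoc_of% M.act_comm x y a b]
    simp

theorem isIdempotentComplete_vModule [IsIdempotentComplete V] :
    IsIdempotentComplete (VModule V B C) := by
  refine ⟨fun M e he => ?_⟩
  have he' (x : C) (b : B) : e.app x b ≫ e.app x b = e.app x b := by rw [← comp_app, he]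
  choose K s r hsr hrs using fun x b =>
    IsIdempotentComplete.idempotents_split (M.obj x b) (e.app x b) (he' x b)
  have hs (x : C) (b : B) : s x b ≫ e.app x b = s x b := by rw [← hrs, reassoc_of% hsr]
  have hr (x : C) (b : B) : e.app x b ≫ r x b = r x b := by
    rw [← hrs, Category.assoc, hsr, Category.comp_id]
  refine ⟨retractModule e K s r hsr hrs,
    { app := s, actL_app := fun x y b => ?_, actR_app := fun x a b => ?_ },
    { app := r, actL_app := fun x y b => ?_, actR_app := fun x a b => ?_ }, ?_, ?_⟩
  · simp only [Category.assoc]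
    rw [hrs, e.actL_app, ← MonoidalCategory.whiskerLeft_comp_assoc, hs]
  · simp only [Category.assoc]
    rw [hrs, e.actR_app, ← comp_whiskerRight_assoc, hs]
  · rw [← MonoidalCategory.whiskerLeft_comp_assoc, hrs, ← reassoc_of% e.actL_app, hr]
  · rw [← comp_whiskerRight_assoc, hrs, ← reassoc_of% e.actR_app, hr]
  · ext x b; exact hsr x b
  · ext x b; exact hrs x b

end Splitting

section Yoneda

variable {E : Type w} [EnrichedCategory V E]

/-- The module `X^* : E ⇸ ℐ` corepresented by an object `X` of `E`, with `X^*(Y) = E(X, Y)`. -/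
def corepresentable (X : E) : VModule V E UnitCat.{w} where
  obj _ y := EnrichedCategory.Hom X y
  actL _ _ _ := (λ_ _).hom
  actR _ y z := eComp V X y z
  actL_id _ y := by
    change 𝟙 _ ▷ _ ≫ _ = _
    simp
  actL_comp _ _ _ y := by
    change (λ_ (𝟙_ V)).hom ▷ EnrichedCategory.Hom X y ≫ (λ_ _).hom =
      (α_ (𝟙_ V) (𝟙_ V) _).hom ≫ 𝟙_ V ◁ (λ_ (EnrichedCategory.Hom X y)).hom ≫ (λ_ _).hom
    rw [triangle_assoc, unitors_equal]
  actR_id _ y := (idModule V E).actR_id X y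
  actR_comp _ y z t := (idModule V E).actR_comp X y z t
  act_comm _ _ y z := by
    change (λ_ (EnrichedCategory.Hom X y)).hom ▷ EnrichedCategory.Hom y z ≫ eComp V X y z =
      (α_ (𝟙_ V) _ _).hom ≫ 𝟙_ V ◁ eComp V X y z ≫ (λ_ _).hom
    simp

/-- The map `E(Y, X) ⟶ E(Y, Z)` given by composition with `f : X ⟶ Z`. -/
def postcompHom (y : E) {X Z : E} (f : 𝟙_ V ⟶ EnrichedCategory.Hom X Z) :
    (EnrichedCategory.Hom y X : V) ⟶ EnrichedCategory.Hom y Z :=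
  (ρ_ (EnrichedCategory.Hom y X)).inv ≫ EnrichedCategory.Hom y X ◁ f ≫ eComp V y X Z

/-- The map `E(X, Y) ⟶ E(Z, Y)` given by composition with `f : Z ⟶ X`. -/
def precompHom {X Z : E} (f : 𝟙_ V ⟶ EnrichedCategory.Hom Z X) (y : E) :
    (EnrichedCategory.Hom X y : V) ⟶ EnrichedCategory.Hom Z y :=
  (λ_ (EnrichedCategory.Hom X y)).inv ≫ f ▷ EnrichedCategory.Hom X y ≫ eComp V Z X y

theorem eComp_postcompHom (y z : E) {X Z : E} (f : 𝟙_ V ⟶ EnrichedCategory.Hom X Z) :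
    eComp V y z X ≫ postcompHom y f =
      EnrichedCategory.Hom y z ◁ postcompHom z f ≫ eComp V y z Z := by
  simp only [postcompHom, MonoidalCategory.whiskerLeft_comp, Category.assoc]
  rw [rightUnitor_inv_naturality_assoc, ← whisker_exchange_assoc, ← e_assoc']
  simp

theorem eComp_precompHom {X Z : E} (f : 𝟙_ V ⟶ EnrichedCategory.Hom Z X) (y z : E) :
    eComp V X y z ≫ precompHom f z =
      precompHom f y ▷ EnrichedCategory.Hom y z ≫ eComp V Z y z := by
  simp only [precompHom, comp_whiskerRight, Category.assoc]
  rw [leftUnitor_inv_naturality_assoc, whisker_exchange_assoc, ← e_assoc]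
  simp [e_assoc']

theorem whiskerLeft_precompHom_eComp {X Z : E} (f : 𝟙_ V ⟶ EnrichedCategory.Hom Z X) (y z : E) :
    EnrichedCategory.Hom y Z ◁ precompHom f z ≫ eComp V y Z z =
      postcompHom y f ▷ EnrichedCategory.Hom X z ≫ eComp V y X z := by
  simp only [precompHom, postcompHom, comp_whiskerRight, MonoidalCategory.whiskerLeft_comp,
    Category.assoc]
  rw [← e_assoc']
  simp

theorem eId_postcompHom {X Z : E} (f : 𝟙_ V ⟶ EnrichedCategory.Hom X Z) :
    eId V X ≫ postcompHom X f = f := by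
  rw [postcompHom, rightUnitor_inv_naturality_assoc, ← whisker_exchange_assoc,
    ← unitors_inv_equal, ← leftUnitor_inv_naturality_assoc, e_id_comp, Category.comp_id]

theorem comp_postcompHom {X Y Z : E} (f : 𝟙_ V ⟶ EnrichedCategory.Hom X Y)
    (g : 𝟙_ V ⟶ EnrichedCategory.Hom Y Z) :
    f ≫ postcompHom X g = (λ_ (𝟙_ V)).inv ≫ (f ⊗ₘ g) ≫ eComp V X Y Z := by
  rw [postcompHom, rightUnitor_inv_naturality_assoc, ← unitors_inv_equal,
    MonoidalCategory.tensorHom_def, Category.assoc]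

theorem precompHom_comp {X Y Z : E} (f : 𝟙_ V ⟶ EnrichedCategory.Hom X Y)
    (g : 𝟙_ V ⟶ EnrichedCategory.Hom Y Z) (y : E) :
    precompHom g y ≫ precompHom f y = precompHom (f ≫ postcompHom X g) y := by
  have h := whiskerLeft_precompHom_eComp g X y
  rw [precompHom, precompHom, precompHom, comp_whiskerRight, Category.assoc _ (postcompHom X g ▷ _),
    ← h, ← whisker_exchange_assoc, ← leftUnitor_inv_naturality_assoc, precompHom]

theorem eq_postcompHom {X Z : E} (y : E)
    (φ : (EnrichedCategory.Hom y X : V) ⟶ EnrichedCategory.Hom y Z)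
    (ψ : (EnrichedCategory.Hom X X : V) ⟶ EnrichedCategory.Hom X Z)
    (h : eComp V y X X ≫ φ = EnrichedCategory.Hom y X ◁ ψ ≫ eComp V y X Z) :
    φ = postcompHom y (eId V X ≫ ψ) := by
  rw [postcompHom, MonoidalCategory.whiskerLeft_comp, Category.assoc, ← h,
    reassoc_of% e_comp_id V y X]

/-- The morphism of representable modules given by composition with `f : X ⟶ Z`. -/
def postcomp {X Z : E} (f : 𝟙_ V ⟶ EnrichedCategory.Hom X Z) :
    representable (V := V) X ⟶ representable Z where
  app y _ := postcompHom y f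
  actL_app y z _ := eComp_postcompHom y z f
  actR_app y _ _ := (rightUnitor_naturality (postcompHom y f)).symm

/-- The morphism of corepresentable modules given by composition with `f : Z ⟶ X`. -/
def precomp {X Z : E} (f : 𝟙_ V ⟶ EnrichedCategory.Hom Z X) :
    corepresentable (V := V) X ⟶ corepresentable Z where
  app _ y := precompHom f y
  actL_app _ _ y := (leftUnitor_naturality (precompHom f y)).symm
  actR_app _ y z := eComp_precompHom f y z

/-- The morphism of the underlying category that corresponds to a morphism of representable
modules under the Yoneda lemma. -/
def yonedaHom {X Z : E} (f : representable (V := V) X ⟶ representable Z) :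
    𝟙_ V ⟶ EnrichedCategory.Hom X Z :=
  eId V X ≫ f.app X UnitCat.star

theorem app_eq_postcompHom {X Z : E} (f : representable (V := V) X ⟶ representable Z) (y : E)
    (b : UnitCat.{w}) : f.app y b = postcompHom y (yonedaHom f) :=
  eq_postcompHom y (f.app y b) (f.app X b) (f.actL_app y X b)

theorem yonedaHom_injective {X Z : E} {f g : representable (V := V) X ⟶ representable Z}
    (h : yonedaHom f = yonedaHom g) : f = g := by
  ext y b
  rw [app_eq_postcompHom, app_eq_postcompHom, h]

theorem yonedaHom_postcomp {X Z : E} (f : 𝟙_ V ⟶ EnrichedCategory.Hom X Z) :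
    yonedaHom (postcomp f) = f :=
  eId_postcompHom f

theorem yonedaHom_id (X : E) : yonedaHom (𝟙 (representable (V := V) X)) = eId V X :=
  Category.comp_id _

theorem yonedaHom_comp {X Y Z : E} (f : representable (V := V) X ⟶ representable Y)
    (g : representable (V := V) Y ⟶ representable Z) :
    yonedaHom (f ≫ g) = (λ_ (𝟙_ V)).inv ≫ (yonedaHom f ⊗ₘ yonedaHom g) ≫ eComp V X Y Z := by
  rw [← comp_postcompHom, ← app_eq_postcompHom g X UnitCat.star]
  exact (Category.assoc _ _ _).symm

end Yoneda

section Adjunction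

variable [SymmetricCategory V] [MonoidalClosed V] [HasColimits V]
variable {B C D E : Type w} [EnrichedCategory V B] [EnrichedCategory V C] [EnrichedCategory V D]
  [EnrichedCategory V E]

/-- The universal property of the composite of two modules. -/
noncomputable def liftHom {M : VModule V C D} {N : VModule V B C} {P : VModule V B D}
    (c : ∀ x a b, M.obj x a ⊗ N.obj a b ⟶ P.obj x b)
    (hc : ∀ x a a' b, M.actR x a a' ▷ N.obj a' b ≫ c x a' b =
      (α_ _ _ _).hom ≫ M.obj x a ◁ N.actL a a' b ≫ c x a b)
    (hL : ∀ x y a b, M.actL x y a ▷ N.obj a b ≫ c x a b =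
      (α_ _ _ _).hom ≫ EnrichedCategory.Hom x y ◁ c y a b ≫ P.actL x y b)
    (hR : ∀ x a b b', M.obj x a ◁ N.actR a b b' ≫ c x a b' =
      (α_ _ _ _).inv ≫ c x a b ▷ EnrichedCategory.Hom b b' ≫ P.actR x b b') :
    compModule M N ⟶ P where
  app x b := lift M N x b (fun a => c x a b) (fun a a' => hc x a a' b)
  actL_app x y b := by
    apply (inj_epi M N y b).whiskerLeft
    intro a
    rw [reassoc_of% inj_actL, inj_lift, ← MonoidalCategory.whiskerLeft_comp_assoc, inj_lift, hL,
      Iso.inv_hom_id_assoc]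
  actR_app x b b' := by
    apply (inj_epi M N x b).whiskerRight
    intro a
    rw [reassoc_of% inj_actR, inj_lift, ← comp_whiskerRight_assoc, inj_lift, hR,
      Iso.hom_inv_id_assoc]

theorem inj_liftHom {M : VModule V C D} {N : VModule V B C} {P : VModule V B D}
    (c : ∀ x a b, M.obj x a ⊗ N.obj a b ⟶ P.obj x b) (hc hL hR) (x : D) (a : C) (b : B) :
    inj M N x a b ≫ (liftHom (P := P) c hc hL hR).app x b = c x a b := by
  simp only [liftHom, inj_lift]

/-- A point of an endomodule of the unit `V`-category gives a morphism from the identity module. -/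
def pointHom {P : VModule V UnitCat.{w} UnitCat.{w}} (p : 𝟙_ V ⟶ P.obj .star .star) :
    idModule V UnitCat.{w} ⟶ P where
  app _ _ := p
  actL_app _ _ _ := by
    have h : 𝟙 (𝟙_ V) ▷ P.obj .star .star ≫ P.actL .star .star .star = (λ_ _).hom :=
      P.actL_id .star .star
    rw [id_whiskerRight, Category.id_comp] at h
    change (λ_ (𝟙_ V)).hom ≫ p = 𝟙_ V ◁ p ≫ P.actL .star .star .star
    erw [h, leftUnitor_naturality]
  actR_app _ _ _ := by
    have h : P.obj .star .star ◁ 𝟙 (𝟙_ V) ≫ P.actR .star .star .star = (ρ_ _).hom :=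
      P.actR_id .star .star
    rw [whiskerLeft_id, Category.id_comp] at h
    change (λ_ (𝟙_ V)).hom ≫ p = p ▷ 𝟙_ V ≫ P.actR .star .star .star
    erw [h, rightUnitor_naturality]
    rw [unitors_equal]

theorem pointHom_left_triangle {M : VModule V UnitCat.{w} E} {N : VModule V E UnitCat.{w}} (X : E)
    (u : 𝟙_ V ⟶ N.obj .star X ⊗ M.obj X .star) (ε : compModule M N ⟶ idModule V E)
    (h : ∀ x, M.obj x .star ◁ u ≫ (α_ _ _ _).inv ≫
      (inj M N x .star X ≫ ε.app x X) ▷ M.obj X .star ≫ M.actL x X .star = (ρ_ _).hom) :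
    whiskL M (pointHom (u ≫ inj N M .star X .star)) ≫ (assoc M N M).inv ≫ whiskR ε M ≫
      (unitL M).hom = (unitR M).hom := by
  ext x ⟨⟩
  apply inj_epi
  rintro ⟨⟩
  have hM : M.obj x .star ◁ 𝟙 (𝟙_ V) ≫ M.actR x .star .star = (ρ_ _).hom := M.actR_id x .star
  rw [whiskerLeft_id, Category.id_comp] at hM
  simp only [comp_app]
  rw [reassoc_of% inj_whiskL, inj_unitR]
  change M.obj x .star ◁ (u ≫ inj N M .star X .star) ≫ _ = M.actR x .star .star
  rw [MonoidalCategory.whiskerLeft_comp, Category.assoc, reassoc_of% inj_inj_assoc',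
    reassoc_of% inj_whiskR, inj_unitL, ← comp_whiskerRight_assoc]
  exact (h x).trans hM.symm

theorem pointHom_right_triangle {M : VModule V UnitCat.{w} E} {N : VModule V E UnitCat.{w}} (X : E)
    (u : 𝟙_ V ⟶ N.obj .star X ⊗ M.obj X .star) (ε : compModule M N ⟶ idModule V E)
    (h : ∀ y, u ▷ N.obj .star y ≫ (α_ _ _ _).hom ≫
      N.obj .star X ◁ (inj M N X .star y ≫ ε.app X y) ≫ N.actR .star X y = (λ_ _).hom) :
    whiskR (pointHom (u ≫ inj N M .star X .star)) N ≫ (assoc N M N).hom ≫ whiskL N ε ≫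
      (unitR N).hom = (unitL N).hom := by
  ext ⟨⟩ y
  apply inj_epi
  rintro ⟨⟩
  have hN : 𝟙 (𝟙_ V) ▷ N.obj .star y ≫ N.actL .star .star y = (λ_ _).hom := N.actL_id .star y
  rw [id_whiskerRight, Category.id_comp] at hN
  simp only [comp_app]
  rw [reassoc_of% inj_whiskR, inj_unitL]
  change (u ≫ inj N M .star X .star) ▷ N.obj .star y ≫ _ = N.actL .star .star y
  rw [comp_whiskerRight, Category.assoc, reassoc_of% inj_inj_assoc,
    reassoc_of% inj_whiskL, inj_unitR, ← MonoidalCategory.whiskerLeft_comp_assoc]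
  exact (h y).trans hN.symm

/-- The unit `1_ℐ ⟶ X^* ∘ X_*`. -/
noncomputable def representableUnit (X : E) :
    idModule V UnitCat.{w} ⟶ compModule (corepresentable X) (representable X) :=
  pointHom (((λ_ (𝟙_ V)).inv ≫ (eId V X ⊗ₘ eId V X)) ≫
    inj (corepresentable X) (representable X) .star X .star)

/-- The counit `X_* ∘ X^* ⟶ 1_E`. -/
noncomputable def representableCounit (X : E) :
    compModule (representable X) (corepresentable X) ⟶ idModule V E :=
  liftHom (M := representable X) (N := corepresentable X) (P := idModule V E)
    (fun x _ y => eComp V x X y)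
    (fun x _ _ y => by
      change (ρ_ (EnrichedCategory.Hom x X)).hom ▷ EnrichedCategory.Hom X y ≫ eComp V x X y =
        (α_ _ (𝟙_ V) _).hom ≫ EnrichedCategory.Hom x X ◁ (λ_ (EnrichedCategory.Hom X y)).hom ≫ _
      rw [triangle_assoc])
    (fun x y _ b => (e_assoc' V x y X b).symm)
    (fun x _ b b' => (e_assoc V x X b b').symm)

theorem inj_representableCounit (X x y : E) (a : UnitCat.{w}) :
    inj (representable X) (corepresentable X) x a y ≫ (representableCounit (V := V) X).app x y =
      eComp V x X y :=
  inj_liftHom (M := representable X) (N := corepresentable X) (P := idModule V E) _ _ _ _ x a y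

theorem representable_left_triangle (X : E) :
    whiskL (representable X) (representableUnit X) ≫
      (assoc (representable X) (corepresentable X) (representable X)).inv ≫
      whiskR (representableCounit X) (representable X) ≫ (unitL (representable X)).hom =
        (unitR (V := V) (representable X)).hom := by
  apply pointHom_left_triangle
  intro x
  rw [inj_representableCounit]
  change EnrichedCategory.Hom x X ◁ ((λ_ (𝟙_ V)).inv ≫ (eId V X ⊗ₘ eId V X)) ≫
    (α_ _ _ _).inv ≫ eComp V x X X ▷ EnrichedCategory.Hom X X ≫ eComp V x X X =
      (ρ_ (EnrichedCategory.Hom x X)).hom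
  rw [e_assoc, ← MonoidalCategory.whiskerLeft_comp_assoc, Category.assoc,
    MonoidalCategory.tensorHom_def', Category.assoc, ← leftUnitor_inv_naturality_assoc, e_id_comp,
    Category.comp_id, ← cancel_epi (ρ_ _).inv, e_comp_id, Iso.inv_hom_id]

theorem representable_right_triangle (X : E) :
    whiskR (representableUnit X) (corepresentable X) ≫
      (assoc (corepresentable X) (representable X) (corepresentable X)).hom ≫
      whiskL (corepresentable X) (representableCounit X) ≫ (unitR (corepresentable X)).hom =
        (unitL (V := V) (corepresentable X)).hom := by
  apply pointHom_right_triangle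
  intro x
  rw [inj_representableCounit]
  change ((λ_ (𝟙_ V)).inv ≫ (eId V X ⊗ₘ eId V X)) ▷ EnrichedCategory.Hom X x ≫
    (α_ _ _ _).hom ≫ EnrichedCategory.Hom X X ◁ eComp V X X x ≫ eComp V X X x =
      (λ_ (EnrichedCategory.Hom X x)).hom
  rw [e_assoc', ← comp_whiskerRight_assoc, Category.assoc,
    MonoidalCategory.tensorHom_def', Category.assoc, ← leftUnitor_inv_naturality_assoc, e_id_comp,
    Category.comp_id, ← cancel_epi (λ_ _).inv, e_id_comp, Iso.inv_hom_id]

/-- The adjunction `X_* ⊣ X^*` in `V-Mod`. -/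
noncomputable def representableAdjunction (X : E) :
    Bicategory.Adjunction (a := ModCat.mk (V := V) UnitCat.{w}) (b := ModCat.mk (V := V) E)
      (representable X) (corepresentable X) where
  unit := representableUnit X
  counit := representableCounit X
  left_triangle := by
    have h := representable_left_triangle (V := V) X
    simp only [← Category.assoc] at h
    rw [← Iso.eq_comp_inv, Category.assoc] at h
    exact (Bicategory.leftZigzag_eq _ _).trans h
  right_triangle := by
    have h := representable_right_triangle (V := V) X
    simp only [← Category.assoc] at h
    rw [← Iso.eq_comp_inv, Category.assoc] at h
    exact (Bicategory.rightZigzag_eq _ _).trans h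

theorem mate_representableCounit {X : E} (f : 𝟙_ V ⟶ EnrichedCategory.Hom X X) :
    whiskL (representable X) (precomp f) ≫ representableCounit X =
      whiskR (postcomp f) (corepresentable X) ≫ representableCounit X := by
  ext x y
  apply inj_epi
  intro a
  simp only [comp_app]
  rw [reassoc_of% inj_whiskL, reassoc_of% inj_whiskR, inj_representableCounit]
  exact whiskerLeft_precompHom_eComp f x y

theorem isCauchy_of_retract {X : E} {M : VModule V UnitCat.{w} E} (s : M ⟶ representable X)
    (r : representable X ⟶ M) (h : s ≫ r = 𝟙 M) : IsCauchy M := by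
  set f := yonedaHom (r ≫ s) with hf
  have hrs : postcomp f = r ≫ s := yonedaHom_injective (yonedaHom_postcomp f)
  have hff : f ≫ postcompHom X f = f := by
    rw [hf, ← app_eq_postcompHom (r ≫ s) X UnitCat.star]
    conv_rhs => rw [show r ≫ s = (r ≫ s) ≫ r ≫ s by rw [Category.assoc, reassoc_of% h]]
    exact Category.assoc _ _ _
  have hp : precomp (V := V) f ≫ precomp f = precomp f := by
    ext a y
    exact (precompHom_comp f f y).trans (congrArg (precompHom · y) hff)
  have := Idempotents.isIdempotentComplete_of_hasCoequalizers V
  obtain ⟨N, j, q, hjq, hqj⟩ :=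
    (isIdempotentComplete_vModule (V := V) (B := E) (C := UnitCat.{w})).idempotents_split _ _ hp
  refine ⟨N, ⟨(representableAdjunction X).retract s r h j q hjq ?_⟩⟩
  have hm := mate_representableCounit f
  rw [hrs, ← hqj] at hm
  exact hm.symm

theorem IsCauchyComplete.exists_splitting (hE : IsCauchyComplete V E) {X : E}
    (f : 𝟙_ V ⟶ EnrichedCategory.Hom X X)
    (hf : (λ_ (𝟙_ V)).inv ≫ (f ⊗ₘ f) ≫ eComp V X X X = f) :
    ∃ (D : E) (i : 𝟙_ V ⟶ EnrichedCategory.Hom D X) (p : 𝟙_ V ⟶ EnrichedCategory.Hom X D),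
      (λ_ (𝟙_ V)).inv ≫ (i ⊗ₘ p) ≫ eComp V D X D = eId V D ∧
        (λ_ (𝟙_ V)).inv ≫ (p ⊗ₘ i) ≫ eComp V X D X = f := by
  have hf' : postcomp f ≫ postcomp f = postcomp f := by
    apply yonedaHom_injective
    rw [yonedaHom_comp, yonedaHom_postcomp, hf]
  have := Idempotents.isIdempotentComplete_of_hasCoequalizers V
  obtain ⟨M, s, r, hsr, hrs⟩ :=
    (isIdempotentComplete_vModule (V := V) (B := UnitCat.{w}) (C := E)).idempotents_split _ _ hf'
  obtain ⟨D, ⟨φ⟩⟩ := hE M (isCauchy_of_retract s r hsr)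
  refine ⟨D, yonedaHom (φ.inv ≫ s), yonedaHom (r ≫ φ.hom), ?_, ?_⟩
  · rw [← yonedaHom_comp, Category.assoc, reassoc_of% hsr, Iso.inv_hom_id, yonedaHom_id]
  · rw [← yonedaHom_comp, Category.assoc, Iso.hom_inv_id_assoc, hrs, yonedaHom_postcomp]

end Adjunction

end EnrichedModule

theorem mainTheorem3 {V : Type u} [Category.{w} V] [MonoidalCategory V] [SymmetricCategory V]
    [MonoidalClosed V] [HasColimits V] (E : Type w) [EnrichedCategory V E]
    (hE : EnrichedModule.IsCauchyComplete V E) :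
    IsIdempotentComplete (ForgetEnrichment V E) := by
  refine ⟨fun X e he => ?_⟩
  obtain ⟨D, i, p, hip, hpi⟩ := hE.exists_splitting
    (X := ForgetEnrichment.to V X) (ForgetEnrichment.homTo V e)
    (by rw [← Category.assoc, ← ForgetEnrichment.homTo_comp, he])
  refine ⟨ForgetEnrichment.of V D, ForgetEnrichment.homOf V i, ForgetEnrichment.homOf V p, ?_, ?_⟩
  · exact (ForgetEnrichment.homOf_comp V i p).symm.trans
      ((congrArg (ForgetEnrichment.homOf V) hip).trans (ForgetEnrichment.homOf_eId V D))
  · exact (ForgetEnrichment.homOf_comp V p i).symm.trans (congrArg (ForgetEnrichment.homOf V) hpi)
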